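/- Let $r_0>0$ and $0<L_0\le 1$ be constants, let $I,J\subseteq\mathbb R$ be open, and let $\xi:I\to\mathbb R$, $h:J\to\mathbb R$ be nowhere vanishing smooth functions. On $M=\{(t,r,\theta,\phi): r\in I,\ \theta\in J\}$ consider the charged Nariai type metric $$ds^2=\frac{r_0^2}{L_0}\bigl(-\xi(r)^2dt^2+dr^2\bigr)+r_0^2\bigl(d\theta^2+h(\theta)^2d\phi^2\bigr).$$ Conventions ($n=4$). The curvature tensor is $R^s_{pqr}=\partial_q\Gamma^s_{pr}-\partial_p\Gamma^s_{qr}+\Gamma^m_{pr}\Gamma^s_{qm}-\Gamma^m_{qr}\Gamma^s_{pm}$, $R_{pqrs}=g_{st}R^t_{pqr}$, $S_{qr}=R^s_{sqr}$, $\kappa=g^{pq}S_{pq}$ (so $S_{33}=h''/h$). For symmetric $(0,2)$-tensors, $(E\wedge A)_{pqrs}=E_{ps}A_{qr}-E_{pr}A_{qs}+E_{qr}A_{ps}-E_{qs}A_{pr}$. The conformal, projective, concircular and conharmonic tensors are $$C=R-\tfrac12\, g\wedge S+\tfrac{\kappa}{12}\, g\wedge g,\qquad P_{pqrs}=R_{pqrs}-\tfrac13(g_{ps}S_{qr}-g_{qs}S_{pr}),$$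 $$W=R-\tfrac{\kappa}{24}\, g\wedge g,\qquad K=R-\tfrac12\, g\wedge S .$$ For a $(0,4)$-tensor $T$, the metric is $T$-$SGK_4$ on a set with associated smooth 1-forms $\Pi,\Phi,\Psi,\Theta$ if there $\nabla T=\Pi\otimes T+\Phi\otimes(S\wedge S)+\Psi\otimes(g\wedge S)+\Theta\otimes(g\wedge g)$; $R$-$SGK_4$ is written $SGK_4$. $T$ is recurrent with 1-form $\Pi$ if $\nabla T=\Pi\otimes T$. Put $$\omega_1=\xi'\xi''-\xi\xi''',\quad \omega_2=h'h''-hh''',\quad \Omega=L_0h\xi''-h''\xi,\quad U_C=\{x\in M: C_x\ne0\}.$$ Write 1-forms by their components in $(t,r,\theta,\phi)$. Then: (i) The metric is $SGK_4$ on $\{\Omega\neq0\}$. On $\{\Omega\ne0,\ \xi''\ne0,\ h''\neq0\}$ one can take $\Psi=0$ and $$\Pi=\Bigl\{0,-\tfrac{\omega_1}{2\xi\xi''},-\tfrac{\omega_2}{2hh''},0\Bigr\},\quad \Phi=\Bigl\{0,-\tfrac{r_0^2h\omega_1}{4\xi''\Omega},\tfrac{r_0^2\xi\omega_2}{4h''\Omega},0\Bigr\},\quad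 \Theta=\Bigl\{0,\tfrac{L_0h''\omega_1}{4r_0^2\xi\Omega},-\tfrac{L_0\xi''\omega_2}{4r_0^2h\Omega},0\Bigr\}.$$ (ii) On $U_C$ the conformal tensor $C$ is recurrent with $\Pi=\Bigl\{0,-\frac{L_0h\omega_1}{\xi(\Omega+2h''\xi)},-\frac{\xi\omega_2}{h(\Omega+2h''\xi)},0\Bigr\}$. (iii) On $\{\Omega\ne0\}$ the metric is $P$-$SGK_4$ with $$\Pi=\Bigl\{0,-\tfrac{L_0h\omega_1}{\xi\Omega},\tfrac{\xi\omega_2}{h\Omega},0\Bigr\},\quad \Phi=\Bigl\{0,\tfrac{L_0r_0^2\xi h^2h''\omega_1}{\Omega^3},-\tfrac{L_0r_0^2\xi^2\xi''h\omega_2}{\Omega^3},0\Bigr\},$$ $$\Psi=\Bigl\{0,-\tfrac{L_0hh''\omega_1(\Omega+2h''\xi)}{\Omega^3},\tfrac{L_0\xi\xi''\omega_2(\Omega+2h''\xi)}{\Omega^3},0\Bigr\},$$ $$\Theta=\Bigl\{0,\tfrac{L_0h''\omega_1(\Omega^2+3L_0\xi\xi''hh'')}{3r_0^2\xi\Omega^3},-\tfrac{L_0\xi''\omega_2(\Omega^2+3L_0\xi\xi''hh'')}{3r_0^2h\Omega^3},0\Bigr\}.$$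 (iv) The metric is $W$-$SGK_4$ on $\{\Omega\ne0\}$. On $\{\Omega\ne0,\ \xi''\ne0,\ h''\ne0\}$ one can take $\Psi=0$, $\Pi$ and $\Phi$ as in (i), and $$\Theta=\Bigl\{0,\tfrac{\omega_1(\Omega^2+6L_0\xi\xi''hh'')}{24r_0^2\xi^2\xi''h\Omega},-\tfrac{\omega_2(\Omega^2+6L_0\xi\xi''hh'')}{24r_0^2\xi h^2h''\Omega},0\Bigr\}.$$ (v) On $U_C$ the conharmonic tensor $K$ is recurrent with the same 1-form $\Pi$ as in (ii). -/

import Mathlib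

open scoped ContDiff

noncomputable section

/- Tensor calculus of a semi-Riemannian metric in a coordinate chart of `ℝⁿ`.
A metric is given by its matrix of components, a tensor field by its component functions. -/
namespace SemiRiemannian

/-- A covariant 2-tensor field in coordinates, `T x p q = T_{pq}(x)`. -/
abbrev Tensor2 (n : ℕ) := (Fin n → ℝ) → Matrix (Fin n) (Fin n) ℝ

/-- A covariant 4-tensor field in coordinates, `T x p q r s = T_{pqrs}(x)`. -/
abbrev Tensor4 (n : ℕ) := (Fin n → ℝ) → Fin n → Fin n → Fin n → Fin n → ℝ

/-- A covector field in coordinates. -/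
abbrev Covector (n : ℕ) := (Fin n → ℝ) → Fin n → ℝ

/-- The partial derivative `∂f/∂xⁱ` at `x`. -/
def pderiv {n : ℕ} (i : Fin n) (f : (Fin n → ℝ) → ℝ) (x : Fin n → ℝ) : ℝ :=
  deriv (fun s : ℝ => f (Function.update x i s)) (x i)

/-- Christoffel symbols of the Levi-Civita connection, `christoffel g k i j x = Γ^k_{ij}(x)`. -/
def christoffel {n : ℕ} (g : Tensor2 n) (k i j : Fin n) (x : Fin n → ℝ) : ℝ :=
  (1 / 2) * ∑ l, (g x)⁻¹ k l *
    (pderiv i (fun y => g y j l) x + pderiv j (fun y => g y i l) x - pderiv l (fun y => g y i j) x)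

/-- The (1,3) curvature tensor `R^s_{pqr}`, with the sign for which
`R(∂_p, ∂_q)∂_r = ∇_q ∇_p ∂_r - ∇_p ∇_q ∂_r = R^s_{pqr} ∂_s`. -/
def curvature {n : ℕ} (g : Tensor2 n) (s p q r : Fin n) (x : Fin n → ℝ) : ℝ :=
  pderiv q (christoffel g s p r) x - pderiv p (christoffel g s q r) x
    + ∑ m, (christoffel g m p r x * christoffel g s q m x
        - christoffel g m q r x * christoffel g s p m x)

/-- The (0,4) curvature tensor `R_{pqrs} = g_{st} R^t_{pqr}`. -/
def riemann {n : ℕ} (g : Tensor2 n) : Tensor4 n := fun x p q r s =>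
  ∑ t, g x s t * curvature g t p q r x

/-- The Ricci tensor `S_{qr} = R^s_{sqr}`. -/
def ricci {n : ℕ} (g : Tensor2 n) : Tensor2 n := fun x =>
  Matrix.of fun q r => ∑ s, curvature g s s q r x

/-- The scalar curvature `κ = g^{pq} S_{pq}`. -/
def scalarCurvature {n : ℕ} (g : Tensor2 n) (x : Fin n → ℝ) : ℝ :=
  ∑ p, ∑ q, (g x)⁻¹ p q * ricci g x p q

/-- The Kulkarni-Nomizu product `E ∧ A` of two symmetric 2-tensors. -/
def kulkarniNomizu {n : ℕ} (E A : Tensor2 n) : Tensor4 n := fun x p q r s =>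
  E x p s * A x q r - E x p r * A x q s + E x q r * A x p s - E x q s * A x p r

/-- The Weyl conformal curvature tensor. -/
def conformal {n : ℕ} (g : Tensor2 n) : Tensor4 n := fun x p q r s =>
  riemann g x p q r s
    - 1 / ((n : ℝ) - 2) * (g x p s * ricci g x q r - g x q s * ricci g x p r
        + ricci g x p s * g x q r - ricci g x q s * g x p r)
    + scalarCurvature g x / (((n : ℝ) - 1) * ((n : ℝ) - 2)) *
        (g x p s * g x q r - g x q s * g x p r)

/-- The projective curvature tensor. -/
def projective {n : ℕ} (g : Tensor2 n) : Tensor4 n := fun x p q r s =>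
  riemann g x p q r s
    - 1 / ((n : ℝ) - 1) * (g x p s * ricci g x q r - g x q s * ricci g x p r)

/-- The concircular curvature tensor. -/
def concircular {n : ℕ} (g : Tensor2 n) : Tensor4 n := fun x p q r s =>
  riemann g x p q r s
    - scalarCurvature g x / ((n : ℝ) * ((n : ℝ) - 1)) * (g x p s * g x q r - g x q s * g x p r)

/-- The conharmonic curvature tensor. -/
def conharmonic {n : ℕ} (g : Tensor2 n) : Tensor4 n := fun x p q r s =>
  riemann g x p q r s
    - 1 / ((n : ℝ) - 2) * (g x p s * ricci g x q r - g x q s * ricci g x p r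
        + ricci g x p s * g x q r - ricci g x q s * g x p r)

/-- The covariant derivative `∇_a T_{pqrs}` of a covariant 4-tensor field. -/
def covDeriv {n : ℕ} (g : Tensor2 n) (T : Tensor4 n) (x : Fin n → ℝ) (a p q r s : Fin n) : ℝ :=
  pderiv a (fun y => T y p q r s) x
    - ∑ m, (christoffel g m a p x * T x m q r s + christoffel g m a q x * T x p m r s
        + christoffel g m a r x * T x p q m s + christoffel g m a s x * T x p q r m)

/-- On `U`, the metric `g` is `T`-super generalized recurrent with associated 1-forms
`Λ, Φ, Ψ, Θ` (smooth on `U`):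
`∇T = Λ ⊗ T + Φ ⊗ (S ∧ S) + Ψ ⊗ (g ∧ S) + Θ ⊗ (g ∧ g)`. -/
def IsSuperGenRecurrentWithOn {n : ℕ} (g : Tensor2 n) (T : Tensor4 n) (Λ Φ Ψ Θ : Covector n)
    (U : Set (Fin n → ℝ)) : Prop :=
  (ContDiffOn ℝ ∞ Λ U ∧ ContDiffOn ℝ ∞ Φ U ∧ ContDiffOn ℝ ∞ Ψ U ∧ ContDiffOn ℝ ∞ Θ U) ∧
  ∀ x ∈ U, ∀ a p q r s : Fin n,
    covDeriv g T x a p q r s =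
      Λ x a * T x p q r s
      + Φ x a * kulkarniNomizu (ricci g) (ricci g) x p q r s
      + Ψ x a * kulkarniNomizu g (ricci g) x p q r s
      + Θ x a * kulkarniNomizu g g x p q r s

/-- On `U`, the metric `g` is `T`-super generalized recurrent (for some smooth 1-forms). -/
def IsSuperGenRecurrentOn {n : ℕ} (g : Tensor2 n) (T : Tensor4 n) (U : Set (Fin n → ℝ)) : Prop :=
  ∃ Λ Φ Ψ Θ : Covector n, IsSuperGenRecurrentWithOn g T Λ Φ Ψ Θ U

/-- On `U`, the tensor `T` is recurrent with recurrence 1-form `Λ` (smooth on `U`):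
`∇T = Λ ⊗ T`. -/
def IsRecurrentWithOn {n : ℕ} (g : Tensor2 n) (T : Tensor4 n) (Λ : Covector n)
    (U : Set (Fin n → ℝ)) : Prop :=
  ContDiffOn ℝ ∞ Λ U ∧
  ∀ x ∈ U, ∀ a p q r s : Fin n, covDeriv g T x a p q r s = Λ x a * T x p q r s

end SemiRiemannian

namespace Nariai

open SemiRiemannian

/-- The charged Nariai type metric
`(r₀² / L₀) (-ξ(r)² dt² + dr²) + r₀² (dθ² + h(θ)² dφ²)` in the coordinates `(t, r, θ, φ)`,
numbered `0, 1, 2, 3`. -/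
def metric (r₀ L₀ : ℝ) (ξ h : ℝ → ℝ) : Tensor2 4 := fun x =>
  Matrix.diagonal
    ![-(r₀ ^ 2 / L₀ * ξ (x 1) ^ 2), r₀ ^ 2 / L₀, r₀ ^ 2, r₀ ^ 2 * h (x 2) ^ 2]

/-- The coordinate domain: `r ∈ I`, `θ ∈ J`, with `t` and `φ` arbitrary. -/
def domain (I J : Set ℝ) : Set (Fin 4 → ℝ) := {x | x 1 ∈ I ∧ x 2 ∈ J}

/-- `ω(f) = f' f'' - f f'''`; thus `ω₁ = ω(ξ)` and `ω₂ = ω(h)`. -/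
def omega (f : ℝ → ℝ) (s : ℝ) : ℝ :=
  deriv f s * deriv (deriv f) s - f s * deriv (deriv (deriv f)) s

/-- `Ω = L₀ h ξ'' - h'' ξ`. -/
def Omega (L₀ : ℝ) (ξ h : ℝ → ℝ) (r θ : ℝ) : ℝ :=
  L₀ * h θ * deriv (deriv ξ) r - deriv (deriv h) θ * ξ r

/-- The 1-form `a(r, θ) dr + b(r, θ) dθ`. -/
def form (a b : ℝ → ℝ → ℝ) : Covector 4 := fun x => ![0, a (x 1) (x 2), b (x 1) (x 2), 0]

end Nariai

end

open SemiRiemannian Nariai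

open scoped Topology

namespace SemiRiemannian

/-! The metric is a product `g = g₀ + g₁` of two surface metrics, and both summands, viewed as
2-tensors on `M`, are parallel. Write `k₀ = L₀ ξ'' / (r₀² ξ)` and `k₁ = h'' / (r₀² h)` for the
curvature functions (minus the Gaussian curvatures, in this sign convention). The Ricci tensor is
`k₀ g₀ + k₁ g₁`, and the five curvature tensors are combinations of the four parallel tensors `block
gᵢ gⱼ`, with coefficients linear in `k₀, k₁`. Hence `∇` differentiates only these coefficients
(`covDeriv_sum_block`, `HasBlockCoeffs.covDeriv`).

The tensors `S ∧ S`, `g ∧ S`, `g ∧ g` have coefficients `2 kᵢ kⱼ`, `kᵢ + kⱼ`, `2`, so each claim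
becomes scalar equations indexed by `(i, j)`. They are governed by `Ω = r₀² ξ h (k₀ - k₁)` and `Ω +
2 h'' ξ = r₀² ξ h (k₀ + k₁)`. Where `k₀ ≠ k₁`, the three products span all symmetric coefficient
matrices, which gives the super generalized recurrence. The conformal and conharmonic tensors are
`k₀ + k₁` times parallel tensors, hence recurrent with 1-form `d log |k₀ + k₁|`. -/

/-! ### Calculus of coordinate partial derivatives. -/

theorem differentiableAt_comp_update {n : ℕ} {f : (Fin n → ℝ) → ℝ} {x : Fin n → ℝ} (i : Fin n)
    (hf : DifferentiableAt ℝ f x) :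
    DifferentiableAt ℝ (fun s : ℝ => f (Function.update x i s)) (x i) := by
  have h1 : DifferentiableAt ℝ f (Function.update x i (x i)) := by simpa using hf
  exact h1.comp (x i) (hasDerivAt_update x i (x i)).differentiableAt

theorem pderiv_congr {n : ℕ} {f f' : (Fin n → ℝ) → ℝ} {x : Fin n → ℝ} (i : Fin n)
    (hf : f =ᶠ[𝓝 x] f') : pderiv i f x = pderiv i f' x := by
  apply Filter.EventuallyEq.deriv_eq
  have hc : Filter.Tendsto (fun s : ℝ => Function.update x i s) (𝓝 (x i)) (𝓝 x) := by
    have := (hasDerivAt_update x i (x i)).continuousAt.tendsto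
    simpa using this
  exact hc.eventually hf

theorem pderiv_add {n : ℕ} {f f' : (Fin n → ℝ) → ℝ} {x : Fin n → ℝ} (i : Fin n)
    (hf : DifferentiableAt ℝ f x) (hf' : DifferentiableAt ℝ f' x) :
    pderiv i (fun y => f y + f' y) x = pderiv i f x + pderiv i f' x :=
  deriv_fun_add (differentiableAt_comp_update i hf) (differentiableAt_comp_update i hf')

theorem pderiv_sub {n : ℕ} {f f' : (Fin n → ℝ) → ℝ} {x : Fin n → ℝ} (i : Fin n)
    (hf : DifferentiableAt ℝ f x) (hf' : DifferentiableAt ℝ f' x) :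
    pderiv i (fun y => f y - f' y) x = pderiv i f x - pderiv i f' x :=
  deriv_fun_sub (differentiableAt_comp_update i hf) (differentiableAt_comp_update i hf')

theorem pderiv_mul {n : ℕ} {f f' : (Fin n → ℝ) → ℝ} {x : Fin n → ℝ} (i : Fin n)
    (hf : DifferentiableAt ℝ f x) (hf' : DifferentiableAt ℝ f' x) :
    pderiv i (fun y => f y * f' y) x = pderiv i f x * f' x + f x * pderiv i f' x := by
  have := deriv_fun_mul (differentiableAt_comp_update i hf) (differentiableAt_comp_update i hf')
  simpa [pderiv] using this

theorem pderiv_sum {n : ℕ} {ι : Type*} (u : Finset ι) {f : ι → (Fin n → ℝ) → ℝ}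
    {x : Fin n → ℝ} (i : Fin n) (hf : ∀ j ∈ u, DifferentiableAt ℝ (f j) x) :
    pderiv i (fun y => ∑ j ∈ u, f j y) x = ∑ j ∈ u, pderiv i (f j) x :=
  deriv_fun_sum fun j hj => differentiableAt_comp_update i (hf j hj)

@[simp]
theorem pderiv_const {n : ℕ} (i : Fin n) (c : ℝ) (x : Fin n → ℝ) :
    pderiv i (fun _ => c) x = 0 :=
  deriv_const _ _

theorem pderiv_const_mul {n : ℕ} (i : Fin n) (c : ℝ) (f : (Fin n → ℝ) → ℝ) (x : Fin n → ℝ) :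
    pderiv i (fun y => c * f y) x = c * pderiv i f x :=
  deriv_const_mul_field c

theorem pderiv_neg {n : ℕ} (i : Fin n) (f : (Fin n → ℝ) → ℝ) (x : Fin n → ℝ) :
    pderiv i (fun y => -f y) x = -pderiv i f x :=
  deriv.fun_neg

theorem pderiv_coord {n : ℕ} (i j : Fin n) (f : ℝ → ℝ) (x : Fin n → ℝ) :
    pderiv i (fun y => f (y j)) x = if i = j then deriv f (x j) else 0 := by
  by_cases hij : i = j
  · subst hij; simp [pderiv]
  · have : j ≠ i := fun e => hij e.symm
    simp [pderiv, hij, this]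

/-! ### Covariant derivatives of combinations of products of parallel 2-tensors. -/

/-- The tensor `E_{ps} A_{qr} - E_{qs} A_{pr}`. -/
def block {n : ℕ} (E A : Tensor2 n) : Tensor4 n := fun x p q r s =>
  E x p s * A x q r - E x q s * A x p r

/-- The 2-tensor field `E` is differentiable at `x` with vanishing covariant derivative. -/
def IsParallelAt {n : ℕ} (g E : Tensor2 n) (x : Fin n → ℝ) : Prop :=
  ∀ p q, DifferentiableAt ℝ (fun y => E y p q) x ∧ ∀ a,
    pderiv a (fun y => E y p q) x =
      ∑ m, (christoffel g m a p x * E x m q + christoffel g m a q x * E x p m)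

/-- By the Leibniz rule, the connection terms of `∇T` cancel the partial derivatives of the parallel
blocks. The formula for `T` is required near `x`, not just at `x`, because it gets differentiated.
-/
theorem covDeriv_sum_block {n : ℕ} {ι : Type*} [Fintype ι] {g : Tensor2 n} {T : Tensor4 n}
    {G : ι → Tensor2 n} {c : ι → ι → (Fin n → ℝ) → ℝ} {x : Fin n → ℝ}
    (hG : ∀ i, IsParallelAt g (G i) x) (hc : ∀ i j, DifferentiableAt ℝ (c i j) x)
    (hT : ∀ᶠ y in 𝓝 x, ∀ p q r s, T y p q r s = ∑ i, ∑ j, c i j y * block (G i) (G j) y p q r s)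
    (a p q r s : Fin n) :
    covDeriv g T x a p q r s =
      ∑ i, ∑ j, pderiv a (c i j) x * block (G i) (G j) x p q r s := by
  have hd : ∀ i p q, DifferentiableAt ℝ (fun y => G i y p q) x := fun i p q => (hG i p q).1
  have hb : ∀ i j, DifferentiableAt ℝ (fun y => block (G i) (G j) y p q r s) x := fun i j =>
    ((hd i p s).mul (hd j q r)).sub ((hd i q s).mul (hd j p r))
  have h1 : pderiv a (fun y => T y p q r s) x =
      ∑ i, ∑ j, (pderiv a (c i j) x * block (G i) (G j) x p q r s +
        c i j x * pderiv a (fun y => block (G i) (G j) y p q r s) x) := by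
    rw [pderiv_congr a (hT.mono fun y hy => hy p q r s),
      pderiv_sum _ _ fun i _ => DifferentiableAt.fun_sum fun j _ => (hc i j).fun_mul (hb i j)]
    refine Finset.sum_congr rfl fun i _ => ?_
    rw [pderiv_sum _ _ fun j _ => (hc i j).fun_mul (hb i j)]
    exact Finset.sum_congr rfl fun j _ => pderiv_mul a (hc i j) (hb i j)
  have h2 : ∀ i j, pderiv a (fun y => block (G i) (G j) y p q r s) x =
      ∑ m, (christoffel g m a p x * block (G i) (G j) x m q r s
        + christoffel g m a q x * block (G i) (G j) x p m r s
        + christoffel g m a r x * block (G i) (G j) x p q m s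
        + christoffel g m a s x * block (G i) (G j) x p q r m) := by
    intro i j
    unfold block
    rw [pderiv_sub a ((hd i p s).fun_mul (hd j q r)) ((hd i q s).fun_mul (hd j p r)),
      pderiv_mul a (hd i p s) (hd j q r), pderiv_mul a (hd i q s) (hd j p r),
      (hG i p s).2, (hG j q r).2, (hG i q s).2, (hG j p r).2]
    simp only [Finset.sum_mul, Finset.mul_sum, ← Finset.sum_add_distrib,
      ← Finset.sum_sub_distrib]
    exact Finset.sum_congr rfl fun m _ => by ring
  have h3 : ∑ m, (christoffel g m a p x * T x m q r s + christoffel g m a q x * T x p m r s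
        + christoffel g m a r x * T x p q m s + christoffel g m a s x * T x p q r m) =
      ∑ i, ∑ j, c i j x * pderiv a (fun y => block (G i) (G j) y p q r s) x := by
    simp only [h2, hT.self_of_nhds, Finset.mul_sum, ← Finset.sum_add_distrib]
    rw [Finset.sum_comm]
    refine Finset.sum_congr rfl fun i _ => ?_
    rw [Finset.sum_comm]
    refine Finset.sum_congr rfl fun j _ => Finset.sum_congr rfl fun m _ => by ring
  unfold covDeriv
  rw [h1, h3, ← Finset.sum_sub_distrib]
  refine Finset.sum_congr rfl fun i _ => ?_
  rw [← Finset.sum_sub_distrib]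
  exact Finset.sum_congr rfl fun j _ => by ring

end SemiRiemannian

/-! ### The Levi-Civita connection of the product metric. -/

namespace Nariai

/-- The Lorentzian factor `(r₀² / L₀) (-ξ² dt² + dr²)` (`i = 0`) and the Riemannian factor
`r₀² (dθ² + h² dφ²)` (`i = 1`) of the metric. -/
noncomputable def factor (r₀ L₀ : ℝ) (ξ h : ℝ → ℝ) : Fin 2 → Tensor2 4 :=
  ![fun x => Matrix.diagonal ![-(r₀ ^ 2 / L₀ * ξ (x 1) ^ 2), r₀ ^ 2 / L₀, 0, 0],
    fun x => Matrix.diagonal ![0, 0, r₀ ^ 2, r₀ ^ 2 * h (x 2) ^ 2]]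

/-- The Christoffel symbols of the metric: `Γ^t_{tr} = ξ'/ξ`, `Γ^r_{tt} = ξ ξ'`,
`Γ^φ_{θφ} = h'/h`, `Γ^θ_{φφ} = -h h'`. -/
noncomputable def gammaTable (u v w z : ℝ) : Fin 4 → Fin 4 → Fin 4 → ℝ :=
  ![![![0, u, 0, 0], ![u, 0, 0, 0], 0, 0], ![![v, 0, 0, 0], 0, 0, 0],
    ![0, 0, 0, ![0, 0, 0, z]], ![0, 0, ![0, 0, 0, w], ![0, 0, w, 0]]]

theorem metric_inv {r₀ L₀ : ℝ} (hr₀ : r₀ ≠ 0) (hL₀ : L₀ ≠ 0) {ξ h : ℝ → ℝ}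
    {x : Fin 4 → ℝ} (hξ0 : ξ (x 1) ≠ 0) (hh0 : h (x 2) ≠ 0) :
    (metric r₀ L₀ ξ h x)⁻¹ = Matrix.diagonal
      ![-(r₀ ^ 2 / L₀ * ξ (x 1) ^ 2)⁻¹, (r₀ ^ 2 / L₀)⁻¹, (r₀ ^ 2)⁻¹,
        (r₀ ^ 2 * h (x 2) ^ 2)⁻¹] := by
  apply Matrix.inv_eq_right_inv
  rw [metric, Matrix.diagonal_mul_diagonal, ← Matrix.diagonal_one]
  congr 1
  funext l
  fin_cases l <;> simp <;> field_simp

theorem christoffel_metric {r₀ L₀ : ℝ} (hr₀ : r₀ ≠ 0) (hL₀ : L₀ ≠ 0) {ξ h : ℝ → ℝ}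
    {x : Fin 4 → ℝ} (hξ : DifferentiableAt ℝ ξ (x 1)) (hh : DifferentiableAt ℝ h (x 2))
    (hξ0 : ξ (x 1) ≠ 0) (hh0 : h (x 2) ≠ 0) (k i j : Fin 4) :
    christoffel (metric r₀ L₀ ξ h) k i j x =
      gammaTable (deriv ξ (x 1) / ξ (x 1)) (ξ (x 1) * deriv ξ (x 1))
        (deriv h (x 2) / h (x 2)) (-(h (x 2) * deriv h (x 2))) k i j := by
  have hinv := metric_inv hr₀ hL₀ hξ0 hh0
  have d1 : deriv (fun s => ξ s ^ 2) (x 1) = 2 * ξ (x 1) * deriv ξ (x 1) := by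
    simpa using deriv_fun_pow hξ 2
  have d2 : deriv (fun s => h s ^ 2) (x 2) = 2 * h (x 2) * deriv h (x 2) := by
    simpa using deriv_fun_pow hh 2
  have p1 : ∀ a, pderiv a (fun y : Fin 4 → ℝ => ξ (y 1) ^ 2) x =
      if a = 1 then 2 * ξ (x 1) * deriv ξ (x 1) else 0 := fun a => by
    rw [pderiv_coord a 1 fun s => ξ s ^ 2, d1]
  have p2 : ∀ a, pderiv a (fun y : Fin 4 → ℝ => h (y 2) ^ 2) x =
      if a = 2 then 2 * h (x 2) * deriv h (x 2) else 0 := fun a => by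
    rw [pderiv_coord a 2 fun s => h s ^ 2, d2]
  have hg : ∀ a b c, pderiv a (fun y => metric r₀ L₀ ξ h y b c) x =
      if b = c then
        ![if a = 1 then -(r₀ ^ 2 / L₀ * (2 * ξ (x 1) * deriv ξ (x 1))) else 0, 0, 0,
          if a = 2 then r₀ ^ 2 * (2 * h (x 2) * deriv h (x 2)) else 0] b else 0 := by
    intro a b c
    by_cases hbc : b = c
    · subst hbc
      fin_cases b <;> simp [metric, pderiv_neg, pderiv_const_mul, p1, p2]
      split_ifs <;> simp
    · simp [metric, hbc]
  unfold christoffel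
  simp only [hg, hinv, Matrix.diagonal_apply, ite_mul, zero_mul, Finset.sum_ite_eq,
    Finset.mem_univ, if_true]
  fin_cases k <;> fin_cases i <;> fin_cases j <;> simp [gammaTable] <;> field_simp

/-- The Christoffel symbols do not mix the two factors, and on each factor the connection restricts
to that of its own metric. -/
theorem isParallelAt_factor {r₀ L₀ : ℝ} (hr₀ : r₀ ≠ 0) (hL₀ : L₀ ≠ 0) {ξ h : ℝ → ℝ}
    {x : Fin 4 → ℝ} (hξ : DifferentiableAt ℝ ξ (x 1)) (hh : DifferentiableAt ℝ h (x 2))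
    (hξ0 : ξ (x 1) ≠ 0) (hh0 : h (x 2) ≠ 0) (i : Fin 2) :
    IsParallelAt (metric r₀ L₀ ξ h) (factor r₀ L₀ ξ h i) x := by
  have d1 : deriv (fun s => ξ s ^ 2) (x 1) = 2 * ξ (x 1) * deriv ξ (x 1) := by
    simpa using deriv_fun_pow hξ 2
  have d2 : deriv (fun s => h s ^ 2) (x 2) = 2 * h (x 2) * deriv h (x 2) := by
    simpa using deriv_fun_pow hh 2
  have p1 : ∀ a, pderiv a (fun y : Fin 4 → ℝ => ξ (y 1) ^ 2) x =
      if a = 1 then 2 * ξ (x 1) * deriv ξ (x 1) else 0 := fun a => by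
    rw [pderiv_coord a 1 fun s => ξ s ^ 2, d1]
  have p2 : ∀ a, pderiv a (fun y : Fin 4 → ℝ => h (y 2) ^ 2) x =
      if a = 2 then 2 * h (x 2) * deriv h (x 2) else 0 := fun a => by
    rw [pderiv_coord a 2 fun s => h s ^ 2, d2]
  have D1 : DifferentiableAt ℝ (fun y : Fin 4 → ℝ => ξ (y 1)) x :=
    hξ.comp x (differentiableAt_apply 1 x)
  have D2 : DifferentiableAt ℝ (fun y : Fin 4 → ℝ => h (y 2)) x :=
    hh.comp x (differentiableAt_apply 2 x)
  intro p q
  constructor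
  · fin_cases i <;> fin_cases p <;> fin_cases q <;> simp [factor]
    · exact (D1.pow 2).const_mul _
    · exact (D2.pow 2).const_mul _
  · intro a
    simp only [christoffel_metric hr₀ hL₀ hξ hh hξ0 hh0]
    fin_cases i <;> fin_cases p <;> fin_cases q <;> fin_cases a <;>
      simp [factor, gammaTable, Fin.sum_univ_four, pderiv_neg, pderiv_const_mul, p1, p2] <;>
      field_simp <;> ring

/-! ### Riemann, Ricci and scalar curvature. -/

/-- The curvature functions of the two factors, so that the Ricci tensor is
`∑ i, curv i • factor i`. -/
noncomputable def curv (r₀ L₀ : ℝ) (ξ h : ℝ → ℝ) : Fin 2 → (Fin 4 → ℝ) → ℝ :=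
  ![fun x => L₀ / r₀ ^ 2 * (deriv (deriv ξ) (x 1) / ξ (x 1)),
    fun x => 1 / r₀ ^ 2 * (deriv (deriv h) (x 2) / h (x 2))]

set_option maxHeartbeats 4000000 in
-- The pointwise algebra behind the curvature, with free reals in place of `ξ, ξ', ξ''` and `h, h',
-- h''`. `D a k i j` plays the role of `∂ₐ Γ^k_{ij}`: its entries are zero in the table slots that
-- do not depend on the coordinate `a`.
theorem gammaTable_curvature {r₀ L₀ : ℝ} (hr₀ : r₀ ≠ 0) (hL₀ : L₀ ≠ 0) {X H : ℝ}
    (hX : X ≠ 0) (hH : H ≠ 0) (X₁ X₂ H₁ H₂ : ℝ) (s p q r : Fin 4) :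
    let Γ := gammaTable (X₁ / X) (X * X₁) (H₁ / H) (-(H * H₁))
    let D : Fin 4 → Fin 4 → Fin 4 → Fin 4 → ℝ := fun a k i j =>
      (if a = 1 then gammaTable ((X₂ * X - X₁ ^ 2) / X ^ 2) (X₁ ^ 2 + X * X₂) 0 0 k i j else 0) +
      (if a = 2 then gammaTable 0 0 ((H₂ * H - H₁ ^ 2) / H ^ 2) (-(H₁ ^ 2 + H * H₂)) k i j else 0)
    D q s p r - D p s q r + ∑ m, (Γ m p r * Γ s q m - Γ m q r * Γ s p m) =
      (if s.val < 2 then L₀ / r₀ ^ 2 * (X₂ / X) *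
        ((if p = s then
            Matrix.diagonal ![-(r₀ ^ 2 / L₀ * X ^ 2), r₀ ^ 2 / L₀, 0, 0] q r else 0) -
          if q = s then
            Matrix.diagonal ![-(r₀ ^ 2 / L₀ * X ^ 2), r₀ ^ 2 / L₀, 0, 0] p r else 0) else 0) +
      (if s.val < 2 then 0 else 1 / r₀ ^ 2 * (H₂ / H) *
        ((if p = s then Matrix.diagonal ![0, 0, r₀ ^ 2, r₀ ^ 2 * H ^ 2] q r else 0) -
          if q = s then Matrix.diagonal ![0, 0, r₀ ^ 2, r₀ ^ 2 * H ^ 2] p r else 0)) := by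
  intro Γ D
  simp only [Γ, D, Fin.sum_univ_four]
  clear D Γ
  fin_cases s <;> fin_cases p <;> fin_cases q <;> fin_cases r <;>
    simp [gammaTable] <;> field_simp <;> ring

set_option maxHeartbeats 1000000 in
theorem riemann_metric {r₀ L₀ : ℝ} (hr₀ : r₀ ≠ 0) (hL₀ : L₀ ≠ 0) {ξ h : ℝ → ℝ}
    {I J : Set ℝ} (hI : IsOpen I) (hJ : IsOpen J)
    (hξ : ContDiffOn ℝ ∞ ξ I) (hh : ContDiffOn ℝ ∞ h J)
    (hξ0 : ∀ r ∈ I, ξ r ≠ 0) (hh0 : ∀ θ ∈ J, h θ ≠ 0)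
    {x : Fin 4 → ℝ} (hx : x ∈ domain I J) :
    (∀ p q r s, riemann (metric r₀ L₀ ξ h) x p q r s =
      ∑ i, curv r₀ L₀ ξ h i x *
        block (factor r₀ L₀ ξ h i) (factor r₀ L₀ ξ h i) x p q r s) ∧
    ricci (metric r₀ L₀ ξ h) x = ∑ i, curv r₀ L₀ ξ h i x • factor r₀ L₀ ξ h i x := by
  have e1 : ∀ {r}, r ∈ I → DifferentiableAt ℝ ξ r := fun hr =>
    (hξ.contDiffAt (hI.mem_nhds hr)).differentiableAt (by simp)
  have e2 : ∀ {r}, r ∈ J → DifferentiableAt ℝ h r := fun hr =>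
    (hh.contDiffAt (hJ.mem_nhds hr)).differentiableAt (by simp)
  have f1 : DifferentiableAt ℝ (deriv ξ) (x 1) :=
    ((hξ.deriv_of_isOpen hI (m := ∞) (by simp)).contDiffAt
      (hI.mem_nhds hx.1)).differentiableAt (by simp)
  have f2 : DifferentiableAt ℝ (deriv h) (x 2) :=
    ((hh.deriv_of_isOpen hJ (m := ∞) (by simp)).contDiffAt
      (hJ.mem_nhds hx.2)).differentiableAt (by simp)
  have hopen : ∀ᶠ y in 𝓝 x, y ∈ domain I J :=
    ((continuous_apply 1).continuousAt.eventually (hI.mem_nhds hx.1)).and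
      ((continuous_apply 2).continuousAt.eventually (hJ.mem_nhds hx.2))
  have hX := hξ0 _ hx.1
  have hH := hh0 _ hx.2
  have dχ : ∀ a k i j, pderiv a (christoffel (metric r₀ L₀ ξ h) k i j) x =
      (if a = 1 then gammaTable
        ((deriv (deriv ξ) (x 1) * ξ (x 1) - deriv ξ (x 1) ^ 2) / ξ (x 1) ^ 2)
        (deriv ξ (x 1) ^ 2 + ξ (x 1) * deriv (deriv ξ) (x 1)) 0 0 k i j else 0) +
      (if a = 2 then gammaTable 0 0
        ((deriv (deriv h) (x 2) * h (x 2) - deriv h (x 2) ^ 2) / h (x 2) ^ 2)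
        (-(deriv h (x 2) ^ 2 + h (x 2) * deriv (deriv h) (x 2))) k i j else 0) := by
    intro a k i j
    -- The table for the Christoffel symbols is valid only on the domain; openness permits
    -- differentiating it.
    rw [pderiv_congr a (hopen.mono fun y hy => christoffel_metric hr₀ hL₀ (e1 hy.1) (e2 hy.2)
      (hξ0 _ hy.1) (hh0 _ hy.2) k i j)]
    have q1 : pderiv a (fun y : Fin 4 → ℝ => deriv ξ (y 1) / ξ (y 1)) x = if a = 1 then
        (deriv (deriv ξ) (x 1) * ξ (x 1) - deriv ξ (x 1) ^ 2) / ξ (x 1) ^ 2 else 0 := by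
      rw [pderiv_coord a 1 fun s => deriv ξ s / ξ s, deriv_fun_div f1 (e1 hx.1) hX]
      simp only [sq]
    have q2 : pderiv a (fun y : Fin 4 → ℝ => ξ (y 1) * deriv ξ (y 1)) x = if a = 1 then
        deriv ξ (x 1) ^ 2 + ξ (x 1) * deriv (deriv ξ) (x 1) else 0 := by
      rw [pderiv_coord a 1 fun s => ξ s * deriv ξ s, deriv_fun_mul (e1 hx.1) f1]
      simp only [sq]
    have q3 : pderiv a (fun y : Fin 4 → ℝ => deriv h (y 2) / h (y 2)) x = if a = 2 then
        (deriv (deriv h) (x 2) * h (x 2) - deriv h (x 2) ^ 2) / h (x 2) ^ 2 else 0 := by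
      rw [pderiv_coord a 2 fun s => deriv h s / h s, deriv_fun_div f2 (e2 hx.2) hH]
      simp only [sq]
    have q4 : pderiv a (fun y : Fin 4 → ℝ => -(h (y 2) * deriv h (y 2))) x = if a = 2 then
        -(deriv h (x 2) ^ 2 + h (x 2) * deriv (deriv h) (x 2)) else 0 := by
      rw [pderiv_neg, pderiv_coord a 2 fun s => h s * deriv h s, deriv_fun_mul (e2 hx.2) f2]
      split_ifs <;> ring
    fin_cases k <;> fin_cases i <;> fin_cases j <;>
      simp [gammaTable, q1, q2, q3, q4]
  -- `R^s_{pqr} = kᵢ (δ^s_p (gᵢ)_{qr} - δ^s_q (gᵢ)_{pr})`, where `i` is the factor containing the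
  -- index `s`: coordinates `0, 1` belong to factor 0, and `2, 3` to factor 1.
  have hc : ∀ s p q r, curvature (metric r₀ L₀ ξ h) s p q r x =
      ∑ i, curv r₀ L₀ ξ h i x * ((if i = if s.val < 2 then 0 else 1 then 1 else 0) *
        ((if p = s then factor r₀ L₀ ξ h i x q r else 0) -
          if q = s then factor r₀ L₀ ξ h i x p r else 0)) := by
    intro s p q r
    unfold curvature
    simp only [dχ, christoffel_metric hr₀ hL₀ (e1 hx.1) (e2 hx.2) hX hH, Fin.sum_univ_two, factor,
      curv]
    refine (gammaTable_curvature hr₀ hL₀ hX hH (deriv ξ (x 1)) (deriv (deriv ξ) (x 1))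
      (deriv h (x 2)) (deriv (deriv h) (x 2)) s p q r).trans ?_
    by_cases hs : s.val < 2 <;> simp [hs]
  constructor
  · intro p q r s
    unfold riemann
    simp only [hc, Fin.sum_univ_four, Fin.sum_univ_two]
    fin_cases s <;> fin_cases p <;> fin_cases q <;> simp [metric, factor, block] <;> ring
  · ext q r
    simp only [ricci, hc, Matrix.of_apply, Fin.sum_univ_four, Fin.sum_univ_two]
    fin_cases q <;> fin_cases r <;> simp [factor]

theorem metric_apply (r₀ L₀ : ℝ) (ξ h : ℝ → ℝ) (x : Fin 4 → ℝ) (p q : Fin 4) :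
    metric r₀ L₀ ξ h x p q = ∑ i, factor r₀ L₀ ξ h i x p q := by
  by_cases hpq : p = q
  · subst hpq
    fin_cases p <;> simp [metric, factor]
  · simp [metric, factor, hpq]

theorem eventually_mem_domain {I J : Set ℝ} (hI : IsOpen I) (hJ : IsOpen J) {x : Fin 4 → ℝ}
    (hx : x ∈ domain I J) : ∀ᶠ y in 𝓝 x, y ∈ domain I J :=
  ((continuous_apply 1).continuousAt.eventually (hI.mem_nhds hx.1)).and
    ((continuous_apply 2).continuousAt.eventually (hJ.mem_nhds hx.2))

/-! ### Block coefficients of the five curvature tensors. -/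

/-- On the set `U`, `T = ∑ i j, (A i j * k₀ + B i j * k₁) (factor i)_{ps} (factor j)_{qr} - ...`,
where `k₀`, `k₁` are the curvature functions of the two factors. -/
def HasBlockCoeffs (r₀ L₀ : ℝ) (ξ h : ℝ → ℝ) (U : Set (Fin 4 → ℝ)) (T : Tensor4 4)
    (A B : Matrix (Fin 2) (Fin 2) ℝ) : Prop :=
  ∀ x ∈ U, ∀ p q r s, T x p q r s =
    ∑ i, ∑ j, (A i j * curv r₀ L₀ ξ h 0 x + B i j * curv r₀ L₀ ξ h 1 x) *
      block (factor r₀ L₀ ξ h i) (factor r₀ L₀ ξ h j) x p q r s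

theorem contDiffOn_form {a b : ℝ → ℝ → ℝ} {U : Set (Fin 4 → ℝ)}
    (ha : ContDiffOn ℝ ∞ (fun x : Fin 4 → ℝ => a (x 1) (x 2)) U)
    (hb : ContDiffOn ℝ ∞ (fun x : Fin 4 → ℝ => b (x 1) (x 2)) U) :
    ContDiffOn ℝ ∞ (form a b) U := by
  rw [contDiffOn_pi]
  intro i
  fin_cases i
  · exact contDiffOn_const
  · exact ha
  · exact hb
  · exact contDiffOn_const

variable {r₀ L₀ : ℝ} {I J : Set ℝ} {ξ h : ℝ → ℝ}

theorem ricci_apply (hr₀ : r₀ ≠ 0) (hL₀ : L₀ ≠ 0)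
    (hI : IsOpen I) (hJ : IsOpen J) (hξ : ContDiffOn ℝ ∞ ξ I) (hh : ContDiffOn ℝ ∞ h J)
    (hξ0 : ∀ r ∈ I, ξ r ≠ 0) (hh0 : ∀ θ ∈ J, h θ ≠ 0) {x : Fin 4 → ℝ} (hx : x ∈ domain I J)
    (p q : Fin 4) :
    ricci (metric r₀ L₀ ξ h) x p q =
      ∑ i, curv r₀ L₀ ξ h i x * factor r₀ L₀ ξ h i x p q := by
  rw [(riemann_metric hr₀ hL₀ hI hJ hξ hh hξ0 hh0 hx).2]
  simp

theorem scalarCurvature_metric (hr₀ : r₀ ≠ 0) (hL₀ : L₀ ≠ 0)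
    (hI : IsOpen I) (hJ : IsOpen J) (hξ : ContDiffOn ℝ ∞ ξ I) (hh : ContDiffOn ℝ ∞ h J)
    (hξ0 : ∀ r ∈ I, ξ r ≠ 0) (hh0 : ∀ θ ∈ J, h θ ≠ 0) {x : Fin 4 → ℝ} (hx : x ∈ domain I J) :
    scalarCurvature (metric r₀ L₀ ξ h) x =
      2 * (curv r₀ L₀ ξ h 0 x + curv r₀ L₀ ξ h 1 x) := by
  unfold scalarCurvature
  simp only [ricci_apply hr₀ hL₀ hI hJ hξ hh hξ0 hh0 hx,
    metric_inv hr₀ hL₀ (hξ0 _ hx.1) (hh0 _ hx.2), Matrix.diagonal_apply, ite_mul, zero_mul,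
    Finset.sum_ite_eq, Finset.mem_univ, if_true, Fin.sum_univ_four, Fin.sum_univ_two]
  have := hξ0 _ hx.1
  have := hh0 _ hx.2
  generalize curv r₀ L₀ ξ h 0 x = k
  generalize curv r₀ L₀ ξ h 1 x = l
  simp [factor]
  field_simp
  ring

theorem hasBlockCoeffs_riemann (hr₀ : r₀ ≠ 0) (hL₀ : L₀ ≠ 0)
    (hI : IsOpen I) (hJ : IsOpen J) (hξ : ContDiffOn ℝ ∞ ξ I) (hh : ContDiffOn ℝ ∞ h J)
    (hξ0 : ∀ r ∈ I, ξ r ≠ 0) (hh0 : ∀ θ ∈ J, h θ ≠ 0) :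
    HasBlockCoeffs r₀ L₀ ξ h (domain I J) (riemann (metric r₀ L₀ ξ h))
      !![1, 0; 0, 0] !![0, 0; 0, 1] := by
  intro x hx p q r s
  rw [(riemann_metric hr₀ hL₀ hI hJ hξ hh hξ0 hh0 hx).1]
  simp [Fin.sum_univ_two]

/-- The correction term is a single `block g S`, not a Kulkarni-Nomizu product, so the coefficient
matrix is not symmetric. This is why `block` is the basic building piece. -/
theorem hasBlockCoeffs_projective (hr₀ : r₀ ≠ 0) (hL₀ : L₀ ≠ 0)
    (hI : IsOpen I) (hJ : IsOpen J) (hξ : ContDiffOn ℝ ∞ ξ I) (hh : ContDiffOn ℝ ∞ h J)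
    (hξ0 : ∀ r ∈ I, ξ r ≠ 0) (hh0 : ∀ θ ∈ J, h θ ≠ 0) :
    HasBlockCoeffs r₀ L₀ ξ h (domain I J) (projective (metric r₀ L₀ ξ h))
      !![2 / 3, 0; -1 / 3, 0] !![0, -1 / 3; 0, 2 / 3] := by
  intro x hx p q r s
  unfold projective
  rw [(riemann_metric hr₀ hL₀ hI hJ hξ hh hξ0 hh0 hx).1]
  simp only [ricci_apply hr₀ hL₀ hI hJ hξ hh hξ0 hh0 hx, metric_apply, block, Fin.sum_univ_two]
  simp
  ring

theorem hasBlockCoeffs_concircular (hr₀ : r₀ ≠ 0) (hL₀ : L₀ ≠ 0)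
    (hI : IsOpen I) (hJ : IsOpen J) (hξ : ContDiffOn ℝ ∞ ξ I) (hh : ContDiffOn ℝ ∞ h J)
    (hξ0 : ∀ r ∈ I, ξ r ≠ 0) (hh0 : ∀ θ ∈ J, h θ ≠ 0) :
    HasBlockCoeffs r₀ L₀ ξ h (domain I J) (concircular (metric r₀ L₀ ξ h))
      !![5 / 6, -1 / 6; -1 / 6, -1 / 6] !![-1 / 6, -1 / 6; -1 / 6, 5 / 6] := by
  intro x hx p q r s
  unfold concircular
  rw [(riemann_metric hr₀ hL₀ hI hJ hξ hh hξ0 hh0 hx).1,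
    scalarCurvature_metric hr₀ hL₀ hI hJ hξ hh hξ0 hh0 hx]
  simp only [metric_apply, block, Fin.sum_univ_two]
  simp
  ring

theorem hasBlockCoeffs_conharmonic (hr₀ : r₀ ≠ 0) (hL₀ : L₀ ≠ 0)
    (hI : IsOpen I) (hJ : IsOpen J) (hξ : ContDiffOn ℝ ∞ ξ I) (hh : ContDiffOn ℝ ∞ h J)
    (hξ0 : ∀ r ∈ I, ξ r ≠ 0) (hh0 : ∀ θ ∈ J, h θ ≠ 0) :
    HasBlockCoeffs r₀ L₀ ξ h (domain I J) (conharmonic (metric r₀ L₀ ξ h))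
      !![0, -1 / 2; -1 / 2, 0] !![0, -1 / 2; -1 / 2, 0] := by
  intro x hx p q r s
  unfold conharmonic
  rw [(riemann_metric hr₀ hL₀ hI hJ hξ hh hξ0 hh0 hx).1]
  simp only [ricci_apply hr₀ hL₀ hI hJ hξ hh hξ0 hh0 hx, metric_apply, block, Fin.sum_univ_two]
  simp
  ring

/-- The two matrices coincide, here as for the conharmonic tensor: the tensor is `k₀ + k₁` times a
parallel one. -/
theorem hasBlockCoeffs_conformal (hr₀ : r₀ ≠ 0) (hL₀ : L₀ ≠ 0)
    (hI : IsOpen I) (hJ : IsOpen J) (hξ : ContDiffOn ℝ ∞ ξ I) (hh : ContDiffOn ℝ ∞ h J)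
    (hξ0 : ∀ r ∈ I, ξ r ≠ 0) (hh0 : ∀ θ ∈ J, h θ ≠ 0) :
    HasBlockCoeffs r₀ L₀ ξ h (domain I J) (conformal (metric r₀ L₀ ξ h))
      !![1 / 3, -1 / 6; -1 / 6, 1 / 3] !![1 / 3, -1 / 6; -1 / 6, 1 / 3] := by
  intro x hx p q r s
  unfold conformal
  rw [(riemann_metric hr₀ hL₀ hI hJ hξ hh hξ0 hh0 hx).1,
    scalarCurvature_metric hr₀ hL₀ hI hJ hξ hh hξ0 hh0 hx]
  simp only [ricci_apply hr₀ hL₀ hI hJ hξ hh hξ0 hh0 hx, metric_apply, block, Fin.sum_univ_two]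
  simp
  ring

/-! ### Covariant derivatives and reduction to scalar equations. -/

theorem hasDerivAt_deriv_deriv_div {f : ℝ → ℝ} {U : Set ℝ} (hU : IsOpen U)
    (hf : ContDiffOn ℝ ∞ f U) {t : ℝ} (ht : t ∈ U) (h0 : f t ≠ 0) :
    HasDerivAt (fun s => deriv (deriv f) s / f s) (-(omega f t / f t ^ 2)) t := by
  have h2 : ContDiffOn ℝ ∞ (deriv (deriv f)) U :=
    (hf.deriv_of_isOpen hU (m := ∞) (by simp)).deriv_of_isOpen hU (by simp)
  have a := ((h2.contDiffAt (hU.mem_nhds ht)).differentiableAt (by simp)).hasDerivAt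
  have b := ((hf.contDiffAt (hU.mem_nhds ht)).differentiableAt (by simp)).hasDerivAt
  refine (a.fun_div b h0).congr_deriv ?_
  unfold omega
  ring

/-- The components of the differentials of the two curvature functions. -/
theorem curv_differential (hI : IsOpen I) (hJ : IsOpen J)
    (hξ : ContDiffOn ℝ ∞ ξ I) (hh : ContDiffOn ℝ ∞ h J)
    (hξ0 : ∀ r ∈ I, ξ r ≠ 0) (hh0 : ∀ θ ∈ J, h θ ≠ 0) {x : Fin 4 → ℝ} (hx : x ∈ domain I J) :
    (∀ i, DifferentiableAt ℝ (curv r₀ L₀ ξ h i) x) ∧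
    (∀ a, pderiv a (curv r₀ L₀ ξ h 0) x =
      if a = 1 then -(L₀ / r₀ ^ 2 * (omega ξ (x 1) / ξ (x 1) ^ 2)) else 0) ∧
    (∀ a, pderiv a (curv r₀ L₀ ξ h 1) x =
      if a = 2 then -(1 / r₀ ^ 2 * (omega h (x 2) / h (x 2) ^ 2)) else 0) := by
  have d1 := hasDerivAt_deriv_deriv_div hI hξ hx.1 (hξ0 _ hx.1)
  have d2 := hasDerivAt_deriv_deriv_div hJ hh hx.2 (hh0 _ hx.2)
  refine ⟨fun i => ?_, fun a => ?_, fun a => ?_⟩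
  · fin_cases i
    · have := d1.differentiableAt.comp x (differentiableAt_apply (𝕜 := ℝ) 1 x)
      exact this.const_mul _
    · have := d2.differentiableAt.comp x (differentiableAt_apply (𝕜 := ℝ) 2 x)
      exact this.const_mul _
  · change pderiv a (fun y : Fin 4 → ℝ => _ * (deriv (deriv ξ) (y 1) / ξ (y 1))) x = _
    rw [pderiv_const_mul, pderiv_coord a 1 fun s => deriv (deriv ξ) s / ξ s, d1.deriv]
    split_ifs <;> ring
  · change pderiv a (fun y : Fin 4 → ℝ => _ * (deriv (deriv h) (y 2) / h (y 2))) x = _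
    rw [pderiv_const_mul, pderiv_coord a 2 fun s => deriv (deriv h) s / h s, d2.deriv]
    split_ifs <;> ring

theorem HasBlockCoeffs.covDeriv (hr₀ : r₀ ≠ 0) (hL₀ : L₀ ≠ 0)
    (hI : IsOpen I) (hJ : IsOpen J) (hξ : ContDiffOn ℝ ∞ ξ I) (hh : ContDiffOn ℝ ∞ h J)
    (hξ0 : ∀ r ∈ I, ξ r ≠ 0) (hh0 : ∀ θ ∈ J, h θ ≠ 0) {T : Tensor4 4}
    {A B : Matrix (Fin 2) (Fin 2) ℝ} (hT : HasBlockCoeffs r₀ L₀ ξ h (domain I J) T A B)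
    {x : Fin 4 → ℝ} (hx : x ∈ domain I J) (a p q r s : Fin 4) :
    covDeriv (metric r₀ L₀ ξ h) T x a p q r s =
      ∑ i, ∑ j, (A i j * (if a = 1 then -(L₀ / r₀ ^ 2 * (omega ξ (x 1) / ξ (x 1) ^ 2)) else 0) +
        B i j * (if a = 2 then -(1 / r₀ ^ 2 * (omega h (x 2) / h (x 2) ^ 2)) else 0)) *
        block (factor r₀ L₀ ξ h i) (factor r₀ L₀ ξ h j) x p q r s := by
  obtain ⟨hd, d0, d1⟩ :=
    curv_differential (r₀ := r₀) (L₀ := L₀) hI hJ hξ hh hξ0 hh0 hx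
  rw [covDeriv_sum_block (G := factor r₀ L₀ ξ h)
    (c := fun i j y => A i j * curv r₀ L₀ ξ h 0 y + B i j * curv r₀ L₀ ξ h 1 y)
    (isParallelAt_factor hr₀ hL₀
      ((hξ.contDiffAt (hI.mem_nhds hx.1)).differentiableAt (by simp))
      ((hh.contDiffAt (hJ.mem_nhds hx.2)).differentiableAt (by simp)) (hξ0 _ hx.1) (hh0 _ hx.2))
    (fun i j => ((hd 0).const_mul _).fun_add ((hd 1).const_mul _))
    ((eventually_mem_domain hI hJ hx).mono hT)]
  refine Finset.sum_congr rfl fun i _ => Finset.sum_congr rfl fun j _ => ?_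
  rw [pderiv_add a ((hd 0).const_mul _) ((hd 1).const_mul _), pderiv_const_mul,
    pderiv_const_mul, d0, d1]

theorem HasBlockCoeffs.isRecurrentWithOn (hr₀ : r₀ ≠ 0) (hL₀ : L₀ ≠ 0)
    (hI : IsOpen I) (hJ : IsOpen J) (hξ : ContDiffOn ℝ ∞ ξ I) (hh : ContDiffOn ℝ ∞ h J)
    (hξ0 : ∀ r ∈ I, ξ r ≠ 0) (hh0 : ∀ θ ∈ J, h θ ≠ 0) {T : Tensor4 4}
    {A B : Matrix (Fin 2) (Fin 2) ℝ} (hT : HasBlockCoeffs r₀ L₀ ξ h (domain I J) T A B)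
    {U : Set (Fin 4 → ℝ)} (hU : U ⊆ domain I J) {Λ : Covector 4} (hΛ : ContDiffOn ℝ ∞ Λ U)
    (hc : ∀ x ∈ U, ∀ a i j,
      A i j * (if a = 1 then -(L₀ / r₀ ^ 2 * (omega ξ (x 1) / ξ (x 1) ^ 2)) else 0) +
        B i j * (if a = 2 then -(1 / r₀ ^ 2 * (omega h (x 2) / h (x 2) ^ 2)) else 0) =
      Λ x a * (A i j * curv r₀ L₀ ξ h 0 x + B i j * curv r₀ L₀ ξ h 1 x)) :
    IsRecurrentWithOn (metric r₀ L₀ ξ h) T Λ U := by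
  refine ⟨hΛ, fun x hx a p q r s => ?_⟩
  rw [hT.covDeriv hr₀ hL₀ hI hJ hξ hh hξ0 hh0 (hU hx), hT x (hU hx), Finset.mul_sum]
  refine Finset.sum_congr rfl fun i _ => ?_
  rw [Finset.mul_sum]
  refine Finset.sum_congr rfl fun j _ => ?_
  rw [hc x hx, mul_assoc]

/-- It suffices to compare the coefficients of `block gᵢ gⱼ`: `S ∧ S`, `g ∧ S` and `g ∧ g`
contribute `2 kᵢ kⱼ`, `kᵢ + kⱼ` and `2`. -/
theorem HasBlockCoeffs.isSuperGenRecurrentWithOn (hr₀ : r₀ ≠ 0) (hL₀ : L₀ ≠ 0)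
    (hI : IsOpen I) (hJ : IsOpen J) (hξ : ContDiffOn ℝ ∞ ξ I) (hh : ContDiffOn ℝ ∞ h J)
    (hξ0 : ∀ r ∈ I, ξ r ≠ 0) (hh0 : ∀ θ ∈ J, h θ ≠ 0) {T : Tensor4 4}
    {A B : Matrix (Fin 2) (Fin 2) ℝ} (hT : HasBlockCoeffs r₀ L₀ ξ h (domain I J) T A B)
    {U : Set (Fin 4 → ℝ)} (hU : U ⊆ domain I J) {Λ Φ Ψ Θ : Covector 4}
    (hΛ : ContDiffOn ℝ ∞ Λ U) (hΦ : ContDiffOn ℝ ∞ Φ U)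
    (hΨ : ContDiffOn ℝ ∞ Ψ U) (hΘ : ContDiffOn ℝ ∞ Θ U)
    (hc : ∀ x ∈ U, ∀ a i j,
      A i j * (if a = 1 then -(L₀ / r₀ ^ 2 * (omega ξ (x 1) / ξ (x 1) ^ 2)) else 0) +
        B i j * (if a = 2 then -(1 / r₀ ^ 2 * (omega h (x 2) / h (x 2) ^ 2)) else 0) =
      Λ x a * (A i j * curv r₀ L₀ ξ h 0 x + B i j * curv r₀ L₀ ξ h 1 x)
        + 2 * Φ x a * (curv r₀ L₀ ξ h i x * curv r₀ L₀ ξ h j x)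
        + Ψ x a * (curv r₀ L₀ ξ h i x + curv r₀ L₀ ξ h j x) + 2 * Θ x a) :
    IsSuperGenRecurrentWithOn (metric r₀ L₀ ξ h) T Λ Φ Ψ Θ U := by
  refine ⟨⟨hΛ, hΦ, hΨ, hΘ⟩, fun x hx a p q r s => ?_⟩
  rw [hT.covDeriv hr₀ hL₀ hI hJ hξ hh hξ0 hh0 (hU hx), hT x (hU hx)]
  simp only [hc x hx, kulkarniNomizu, ricci_apply hr₀ hL₀ hI hJ hξ hh hξ0 hh0 (hU hx),
    metric_apply, block, Fin.sum_univ_two]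
  ring

/-! ### Smoothness of the associated 1-forms. -/

/-- The components of the associated 1-forms are built by field operations from the functions
listed here, which are smooth on any subset of the domain. -/
theorem contDiffOn_components {L₀ : ℝ} {I J : Set ℝ} {ξ h : ℝ → ℝ} (hI : IsOpen I)
    (hJ : IsOpen J) (hξ : ContDiffOn ℝ ∞ ξ I) (hh : ContDiffOn ℝ ∞ h J)
    {U : Set (Fin 4 → ℝ)} (hU : U ⊆ domain I J) :
    (ContDiffOn ℝ ∞ (fun x : Fin 4 → ℝ => ξ (x 1)) U ∧
      ContDiffOn ℝ ∞ (fun x : Fin 4 → ℝ => deriv (deriv ξ) (x 1)) U ∧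
      ContDiffOn ℝ ∞ (fun x : Fin 4 → ℝ => omega ξ (x 1)) U) ∧
    (ContDiffOn ℝ ∞ (fun x : Fin 4 → ℝ => h (x 2)) U ∧
      ContDiffOn ℝ ∞ (fun x : Fin 4 → ℝ => deriv (deriv h) (x 2)) U ∧
      ContDiffOn ℝ ∞ (fun x : Fin 4 → ℝ => omega h (x 2)) U) ∧
    ContDiffOn ℝ ∞ (fun x : Fin 4 → ℝ => Omega L₀ ξ h (x 1) (x 2)) U := by
  have aux : ∀ {f : ℝ → ℝ} {K : Set ℝ} (i : Fin 4), IsOpen K → ContDiffOn ℝ ∞ f K →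
      (∀ x ∈ U, x i ∈ K) → ContDiffOn ℝ ∞ (fun x : Fin 4 → ℝ => f (x i)) U ∧
        ContDiffOn ℝ ∞ (fun x : Fin 4 → ℝ => deriv (deriv f) (x i)) U ∧
        ContDiffOn ℝ ∞ (fun x : Fin 4 → ℝ => omega f (x i)) U := by
    intro f K i hK hf hi
    have c : ∀ {u : ℝ → ℝ}, ContDiffOn ℝ ∞ u K → ContDiffOn ℝ ∞ (fun x : Fin 4 → ℝ => u (x i)) U :=
      fun hu => hu.comp (contDiff_apply ℝ ℝ i).contDiffOn hi
    have h1 := hf.deriv_of_isOpen hK (m := ∞) (by simp)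
    have h2 := h1.deriv_of_isOpen hK (m := ∞) (by simp)
    have h3 := h2.deriv_of_isOpen hK (m := ∞) (by simp)
    exact ⟨c hf, c h2, ((c h1).mul (c h2)).sub ((c hf).mul (c h3))⟩
  have a := aux 1 hI hξ fun x hx => (hU hx).1
  have b := aux 2 hJ hh fun x hx => (hU hx).2
  exact ⟨a, b, ((contDiffOn_const.mul b.1).mul a.2.1).sub (b.2.1.mul a.1)⟩

end Nariai

/-! ### The theorem: verification of the scalar equations. -/

set_option maxHeartbeats 4000000 in
theorem mainTheorem7 (r₀ L₀ : ℝ) (hr₀ : 0 < r₀) (hL₀ : 0 < L₀) (hL₀' : L₀ ≤ 1)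
    (I J : Set ℝ) (hI : IsOpen I) (hJ : IsOpen J)
    (ξ h : ℝ → ℝ) (hξ : ContDiffOn ℝ ∞ ξ I) (hh : ContDiffOn ℝ ∞ h J)
    (hξ0 : ∀ r ∈ I, ξ r ≠ 0) (hh0 : ∀ θ ∈ J, h θ ≠ 0) :
    let g := Nariai.metric r₀ L₀ ξ h
    let M := Nariai.domain I J
    let ξ₂ : ℝ → ℝ := deriv (deriv ξ)
    let h₂ : ℝ → ℝ := deriv (deriv h)
    let ω₁ : ℝ → ℝ := Nariai.omega ξ
    let ω₂ : ℝ → ℝ := Nariai.omega h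
    let Ω : ℝ → ℝ → ℝ := Nariai.Omega L₀ ξ h
    let M_Ω : Set (Fin 4 → ℝ) := {x ∈ M | Ω (x 1) (x 2) ≠ 0}
    let M_Ω' : Set (Fin 4 → ℝ) := {x ∈ M_Ω | ξ₂ (x 1) ≠ 0 ∧ h₂ (x 2) ≠ 0}
    let U_C : Set (Fin 4 → ℝ) := {x ∈ M | conformal g x ≠ 0}
    -- the Riemann tensor
    (IsSuperGenRecurrentOn g (riemann g) M_Ω ∧
      IsSuperGenRecurrentWithOn g (riemann g)
        (form (fun r _ => -(ω₁ r / (2 * ξ r * ξ₂ r)))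
          (fun _ θ => -(ω₂ θ / (2 * h θ * h₂ θ))))
        (form (fun r θ => -(r₀ ^ 2 * h θ * ω₁ r / (4 * ξ₂ r * Ω r θ)))
          (fun r θ => r₀ ^ 2 * ξ r * ω₂ θ / (4 * h₂ θ * Ω r θ)))
        0
        (form (fun r θ => L₀ * h₂ θ * ω₁ r / (4 * r₀ ^ 2 * ξ r * Ω r θ))
          (fun r θ => -(L₀ * ξ₂ r * ω₂ θ / (4 * r₀ ^ 2 * h θ * Ω r θ))))
        M_Ω') ∧
    -- the conformal tensor
    IsRecurrentWithOn g (conformal g)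
      (form (fun r θ => -(L₀ * ω₁ r * h θ / (ξ r * (Ω r θ + 2 * h₂ θ * ξ r))))
        (fun r θ => -(ξ r * ω₂ θ / (h θ * (Ω r θ + 2 * h₂ θ * ξ r)))))
      U_C ∧
    -- the projective tensor
    IsSuperGenRecurrentWithOn g (projective g)
      (form (fun r θ => -(L₀ * h θ * ω₁ r / (ξ r * Ω r θ)))
        (fun r θ => ξ r * ω₂ θ / (h θ * Ω r θ)))
      (form (fun r θ => L₀ * r₀ ^ 2 * ξ r * h θ ^ 2 * h₂ θ * ω₁ r / Ω r θ ^ 3)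
        (fun r θ => -(L₀ * r₀ ^ 2 * ξ r ^ 2 * ξ₂ r * h θ * ω₂ θ / Ω r θ ^ 3)))
      (form (fun r θ => -(L₀ * h θ * h₂ θ * ω₁ r * (Ω r θ + 2 * h₂ θ * ξ r) / Ω r θ ^ 3))
        (fun r θ => L₀ * ξ r * ξ₂ r * ω₂ θ * (Ω r θ + 2 * h₂ θ * ξ r) / Ω r θ ^ 3))
      (form
        (fun r θ => L₀ * h₂ θ * ω₁ r * (Ω r θ ^ 2 + 3 * L₀ * ξ r * ξ₂ r * h θ * h₂ θ) /
          (3 * r₀ ^ 2 * ξ r * Ω r θ ^ 3))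
        (fun r θ => -(L₀ * ξ₂ r * ω₂ θ * (Ω r θ ^ 2 + 3 * L₀ * ξ r * ξ₂ r * h θ * h₂ θ) /
          (3 * r₀ ^ 2 * h θ * Ω r θ ^ 3))))
      M_Ω ∧
    -- the concircular tensor
    (IsSuperGenRecurrentOn g (concircular g) M_Ω ∧
      IsSuperGenRecurrentWithOn g (concircular g)
        (form (fun r _ => -(ω₁ r / (2 * ξ r * ξ₂ r)))
          (fun _ θ => -(ω₂ θ / (2 * h θ * h₂ θ))))
        (form (fun r θ => -(r₀ ^ 2 * h θ * ω₁ r / (4 * ξ₂ r * Ω r θ)))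
          (fun r θ => r₀ ^ 2 * ξ r * ω₂ θ / (4 * h₂ θ * Ω r θ)))
        0
        (form
          (fun r θ => ω₁ r * (Ω r θ ^ 2 + 6 * L₀ * ξ r * ξ₂ r * h θ * h₂ θ) /
            (24 * r₀ ^ 2 * ξ r ^ 2 * ξ₂ r * h θ * Ω r θ))
          (fun r θ => -(ω₂ θ * (Ω r θ ^ 2 + 6 * L₀ * ξ r * ξ₂ r * h θ * h₂ θ) /
            (24 * r₀ ^ 2 * ξ r * h θ ^ 2 * h₂ θ * Ω r θ))))
        M_Ω') ∧
    -- the conharmonic tensor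
    IsRecurrentWithOn g (conharmonic g)
      (form (fun r θ => -(L₀ * h θ * ω₁ r / (ξ r * (Ω r θ + 2 * ξ r * h₂ θ))))
        (fun r θ => -(ξ r * ω₂ θ / (h θ * (Ω r θ + 2 * ξ r * h₂ θ)))))
      U_C := by
  intro g M ξ₂ h₂ ω₁ ω₂ Ω M_Ω M_Ω' U_C
  have hr := hr₀.ne'
  have hL := hL₀.ne'
  have hM : M_Ω ⊆ domain I J := fun x hx => hx.1
  have hM' : M_Ω' ⊆ domain I J := fun x hx => hx.1.1
  have hUC : U_C ⊆ domain I J := fun x hx => hx.1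
  have hR := hasBlockCoeffs_riemann hr hL hI hJ hξ hh hξ0 hh0
  have hC := hasBlockCoeffs_conformal hr hL hI hJ hξ hh hξ0 hh0
  have hP := hasBlockCoeffs_projective hr hL hI hJ hξ hh hξ0 hh0
  have hW := hasBlockCoeffs_concircular hr hL hI hJ hξ hh hξ0 hh0
  have hK := hasBlockCoeffs_conharmonic hr hL hI hJ hξ hh hξ0 hh0
  -- The expression equals `r₀² ξ h (k₀ + k₁)`; if it vanished, so would every coefficient of the
  -- conformal tensor.
  have hUC0 : ∀ x ∈ U_C, Ω (x 1) (x 2) + 2 * ξ (x 1) * h₂ (x 2) ≠ 0 := by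
    intro x hx h0
    have hX := hξ0 _ hx.1.1
    have hH := hh0 _ hx.1.2
    have hk : curv r₀ L₀ ξ h 1 x = -curv r₀ L₀ ξ h 0 x := by
      simp only [Ω, h₂, Omega] at h0
      simp only [curv, Matrix.cons_val_zero, Matrix.cons_val_one]
      field_simp
      linear_combination h0
    refine hx.2 ?_
    funext p q r s
    rw [hC x hx.1, hk]
    simp
  have hc₀ : ∀ x, curv r₀ L₀ ξ h 0 x = L₀ / r₀ ^ 2 * (ξ₂ (x 1) / ξ (x 1)) := fun _ => rfl
  have hc₁ : ∀ x, curv r₀ L₀ ξ h 1 x = 1 / r₀ ^ 2 * (h₂ (x 2) / h (x 2)) := fun _ => rfl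
  have hw₁ : omega ξ = ω₁ := rfl
  have hw₂ : omega h = ω₂ := rfl
  have hΩ : ∀ r θ, Ω r θ = L₀ * h θ * ξ₂ r - h₂ θ * ξ r := fun _ _ => rfl
  have smooth : ∀ U ⊆ domain I J, (ContDiffOn ℝ ∞ (fun x : Fin 4 → ℝ => ξ (x 1)) U ∧
      ContDiffOn ℝ ∞ (fun x : Fin 4 → ℝ => ξ₂ (x 1)) U ∧
      ContDiffOn ℝ ∞ (fun x : Fin 4 → ℝ => ω₁ (x 1)) U) ∧
    (ContDiffOn ℝ ∞ (fun x : Fin 4 → ℝ => h (x 2)) U ∧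
      ContDiffOn ℝ ∞ (fun x : Fin 4 → ℝ => h₂ (x 2)) U ∧
      ContDiffOn ℝ ∞ (fun x : Fin 4 → ℝ => ω₂ (x 2)) U) ∧
    ContDiffOn ℝ ∞ (fun x : Fin 4 → ℝ => Ω (x 1) (x 2)) U :=
    fun U hU => contDiffOn_components hI hJ hξ hh hU
  -- From here the derivatives and `Ω` are opaque atoms, accessible only through the equations just
  -- recorded.
  clear_value ξ₂ h₂ ω₁ ω₂ Ω
  -- With `Π = 0` the three equations have a unique solution: `Φ = (dk₀ + dk₁) / (2 (k₀ - k₁)²)`, `Ψ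
  -- = -(k₁ dk₀ + k₀ dk₁) / (k₀ - k₁)²`, `Θ = (k₁² dk₀ + k₀² dk₁) / (2 (k₀ - k₁)²)`. Only `Ω` must
  -- be nonzero, whereas the solution with `Ψ = 0` also divides by `ξ''` and `h''`.
  refine ⟨⟨⟨0, form (fun r θ => -(L₀ * r₀ ^ 2 * h θ ^ 2 * ω₁ r / (2 * Ω r θ ^ 2)))
        (fun r θ => -(r₀ ^ 2 * ξ r ^ 2 * ω₂ θ / (2 * Ω r θ ^ 2))),
      form (fun r θ => L₀ * h θ * h₂ θ * ω₁ r / Ω r θ ^ 2)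
        (fun r θ => L₀ * ξ r * ξ₂ r * ω₂ θ / Ω r θ ^ 2),
      form (fun r θ => -(L₀ * h₂ θ ^ 2 * ω₁ r / (2 * r₀ ^ 2 * Ω r θ ^ 2)))
        (fun r θ => -(L₀ ^ 2 * ξ₂ r ^ 2 * ω₂ θ / (2 * r₀ ^ 2 * Ω r θ ^ 2))), ?_⟩, ?_⟩,
    ?_, ?_, ⟨⟨0, form (fun r θ => -(L₀ * r₀ ^ 2 * h θ ^ 2 * ω₁ r / (2 * Ω r θ ^ 2)))
        (fun r θ => -(r₀ ^ 2 * ξ r ^ 2 * ω₂ θ / (2 * Ω r θ ^ 2))),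
      form (fun r θ => L₀ * h θ * h₂ θ * ω₁ r / Ω r θ ^ 2)
        (fun r θ => L₀ * ξ r * ξ₂ r * ω₂ θ / Ω r θ ^ 2),
      -- The Riemann solution with `Θ` replaced by `Θ - dκ / 24`, since `W = R - (κ / 24) g ∧ g`.
      form (fun r θ => L₀ * ω₁ r / (12 * r₀ ^ 2 * ξ r ^ 2)
          - L₀ * h₂ θ ^ 2 * ω₁ r / (2 * r₀ ^ 2 * Ω r θ ^ 2))
        (fun r θ => ω₂ θ / (12 * r₀ ^ 2 * h θ ^ 2)
          - L₀ ^ 2 * ξ₂ r ^ 2 * ω₂ θ / (2 * r₀ ^ 2 * Ω r θ ^ 2)), ?_⟩, ?_⟩, ?_⟩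
  · refine hR.isSuperGenRecurrentWithOn hr hL hI hJ hξ hh hξ0 hh0 hM ?_ ?_ ?_ ?_ ?_
    rotate_right
    · intro x hx a i j
      have n0 := hξ0 _ (hM hx).1
      have n1 := hh0 _ (hM hx).2
      have n2 := hx.2
      rw [hw₁, hw₂]
      -- `Ω` stays an atom while denominators are cleared, and is expanded only for the closing
      -- polynomial identity.
      fin_cases a <;> fin_cases i <;> fin_cases j <;> simp [form, hc₀, hc₁] <;>
        field_simp <;> simp only [hΩ] <;> ring
    all_goals
      obtain ⟨⟨s1, s2, s3⟩, ⟨s4, s5, s6⟩, s7⟩ := smooth _ hM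
      first
        | exact contDiffOn_const
        | refine contDiffOn_form ?_ ?_
      all_goals repeat' first
        | assumption
        | exact contDiffOn_const
        | apply ContDiffOn.neg
        | apply ContDiffOn.add
        | apply ContDiffOn.sub
        | apply ContDiffOn.div
        | apply ContDiffOn.mul
        | apply ContDiffOn.pow
      all_goals
        intro x hx
        have n0 := hξ0 _ (hM hx).1
        have n1 := hh0 _ (hM hx).2
        have n2 := hx.2
        positivity
  -- Requiring `Ψ = 0` forces `Π = dk₀ / (2 k₀) + dk₁ / (2 k₁)`.
  · refine hR.isSuperGenRecurrentWithOn hr hL hI hJ hξ hh hξ0 hh0 hM' ?_ ?_ ?_ ?_ ?_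
    rotate_right
    · intro x hx a i j
      have n0 := hξ0 _ (hM' hx).1
      have n1 := hh0 _ (hM' hx).2
      have n2 := hx.1.2
      have n3 := hx.2.1
      have n4 := hx.2.2
      rw [hw₁, hw₂]
      fin_cases a <;> fin_cases i <;> fin_cases j <;> simp [form, hc₀, hc₁] <;>
        field_simp <;> simp only [hΩ] <;> ring
    all_goals
      obtain ⟨⟨s1, s2, s3⟩, ⟨s4, s5, s6⟩, s7⟩ := smooth _ hM'
      first
        | exact contDiffOn_const
        | refine contDiffOn_form ?_ ?_
      all_goals repeat' first
        | assumption
        | exact contDiffOn_const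
        | apply ContDiffOn.neg
        | apply ContDiffOn.add
        | apply ContDiffOn.sub
        | apply ContDiffOn.div
        | apply ContDiffOn.mul
        | apply ContDiffOn.pow
      all_goals
        intro x hx
        have n0 := hξ0 _ (hM' hx).1
        have n1 := hh0 _ (hM' hx).2
        have n2 := hx.1.2
        have n3 := hx.2.1
        have n4 := hx.2.2
        positivity
  · refine hC.isRecurrentWithOn hr hL hI hJ hξ hh hξ0 hh0 hUC ?_ ?_
    rotate_right
    · intro x hx a i j
      have n0 := hξ0 _ (hUC hx).1
      have n1 := hh0 _ (hUC hx).2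
      have n2 : Ω (x 1) (x 2) + 2 * h₂ (x 2) * ξ (x 1) ≠ 0 := by simpa only [mul_right_comm] using hUC0 x hx
      -- Naming the sum makes it an atom that can be cancelled as a denominator.
      obtain ⟨D, hD⟩ : ∃ D, Ω (x 1) (x 2) + 2 * h₂ (x 2) * ξ (x 1) = D := ⟨_, rfl⟩
      have hD' : D = L₀ * h (x 2) * ξ₂ (x 1) + h₂ (x 2) * ξ (x 1) := by
        rw [← hD, hΩ]; ring
      rw [hD] at n2
      rw [hw₁, hw₂]
      fin_cases a <;> fin_cases i <;> fin_cases j <;> simp [form, hc₀, hc₁, hD] <;>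
        field_simp <;> simp only [hD'] <;> ring
    all_goals
      obtain ⟨⟨s1, s2, s3⟩, ⟨s4, s5, s6⟩, s7⟩ := smooth _ hUC
      first
        | exact contDiffOn_const
        | refine contDiffOn_form ?_ ?_
      all_goals repeat' first
        | assumption
        | exact contDiffOn_const
        | apply ContDiffOn.neg
        | apply ContDiffOn.add
        | apply ContDiffOn.sub
        | apply ContDiffOn.div
        | apply ContDiffOn.mul
        | apply ContDiffOn.pow
      all_goals
        intro x hx
        have n0 := hξ0 _ (hUC hx).1
        have n1 := hh0 _ (hUC hx).2
        have n2 : Ω (x 1) (x 2) + 2 * h₂ (x 2) * ξ (x 1) ≠ 0 := by simpa only [mul_right_comm] using hUC0 x hx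
        exact mul_ne_zero (by assumption) n2
  -- The three products are symmetric in `(i, j)`, so `Π` alone must account for the skew part of
  -- the coefficients of `P`, a multiple of `k₀ - k₁`. Hence `Π = d log |k₀ - k₁|`, and the
  -- symmetric part then determines `Φ, Ψ, Θ`.
  · refine hP.isSuperGenRecurrentWithOn hr hL hI hJ hξ hh hξ0 hh0 hM ?_ ?_ ?_ ?_ ?_
    rotate_right
    · intro x hx a i j
      have n0 := hξ0 _ (hM hx).1
      have n1 := hh0 _ (hM hx).2
      have n2 := hx.2
      rw [hw₁, hw₂]
      fin_cases a <;> fin_cases i <;> fin_cases j <;> simp [form, hc₀, hc₁] <;>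
        field_simp <;> simp only [hΩ] <;> ring
    all_goals
      obtain ⟨⟨s1, s2, s3⟩, ⟨s4, s5, s6⟩, s7⟩ := smooth _ hM
      first
        | exact contDiffOn_const
        | refine contDiffOn_form ?_ ?_
      all_goals repeat' first
        | assumption
        | exact contDiffOn_const
        | apply ContDiffOn.neg
        | apply ContDiffOn.add
        | apply ContDiffOn.sub
        | apply ContDiffOn.div
        | apply ContDiffOn.mul
        | apply ContDiffOn.pow
      all_goals
        intro x hx
        have n0 := hξ0 _ (hM hx).1
        have n1 := hh0 _ (hM hx).2
        have n2 := hx.2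
        positivity
  · refine hW.isSuperGenRecurrentWithOn hr hL hI hJ hξ hh hξ0 hh0 hM ?_ ?_ ?_ ?_ ?_
    rotate_right
    · intro x hx a i j
      have n0 := hξ0 _ (hM hx).1
      have n1 := hh0 _ (hM hx).2
      have n2 := hx.2
      rw [hw₁, hw₂]
      fin_cases a <;> fin_cases i <;> fin_cases j <;> simp [form, hc₀, hc₁] <;>
        field_simp <;> simp only [hΩ] <;> ring
    all_goals
      obtain ⟨⟨s1, s2, s3⟩, ⟨s4, s5, s6⟩, s7⟩ := smooth _ hM
      first
        | exact contDiffOn_const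
        | refine contDiffOn_form ?_ ?_
      all_goals repeat' first
        | assumption
        | exact contDiffOn_const
        | apply ContDiffOn.neg
        | apply ContDiffOn.add
        | apply ContDiffOn.sub
        | apply ContDiffOn.div
        | apply ContDiffOn.mul
        | apply ContDiffOn.pow
      all_goals
        intro x hx
        have n0 := hξ0 _ (hM hx).1
        have n1 := hh0 _ (hM hx).2
        have n2 := hx.2
        positivity
  -- `Π` and `Φ` are those of the Riemann tensor; `Θ` changes by `-(dκ - κ Π) / 24`.
  · refine hW.isSuperGenRecurrentWithOn hr hL hI hJ hξ hh hξ0 hh0 hM' ?_ ?_ ?_ ?_ ?_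
    rotate_right
    · intro x hx a i j
      have n0 := hξ0 _ (hM' hx).1
      have n1 := hh0 _ (hM' hx).2
      have n2 := hx.1.2
      have n3 := hx.2.1
      have n4 := hx.2.2
      rw [hw₁, hw₂]
      fin_cases a <;> fin_cases i <;> fin_cases j <;> simp [form, hc₀, hc₁] <;>
        field_simp <;> simp only [hΩ] <;> ring
    all_goals
      obtain ⟨⟨s1, s2, s3⟩, ⟨s4, s5, s6⟩, s7⟩ := smooth _ hM'
      first
        | exact contDiffOn_const
        | refine contDiffOn_form ?_ ?_
      all_goals repeat' first
        | assumption
        | exact contDiffOn_const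
        | apply ContDiffOn.neg
        | apply ContDiffOn.add
        | apply ContDiffOn.sub
        | apply ContDiffOn.div
        | apply ContDiffOn.mul
        | apply ContDiffOn.pow
      all_goals
        intro x hx
        have n0 := hξ0 _ (hM' hx).1
        have n1 := hh0 _ (hM' hx).2
        have n2 := hx.1.2
        have n3 := hx.2.1
        have n4 := hx.2.2
        positivity
  · refine hK.isRecurrentWithOn hr hL hI hJ hξ hh hξ0 hh0 hUC ?_ ?_
    rotate_right
    · intro x hx a i j
      have n0 := hξ0 _ (hUC hx).1
      have n1 := hh0 _ (hUC hx).2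
      have n2 : Ω (x 1) (x 2) + 2 * ξ (x 1) * h₂ (x 2) ≠ 0 := hUC0 x hx
      obtain ⟨D, hD⟩ : ∃ D, Ω (x 1) (x 2) + 2 * ξ (x 1) * h₂ (x 2) = D := ⟨_, rfl⟩
      have hD' : D = L₀ * h (x 2) * ξ₂ (x 1) + h₂ (x 2) * ξ (x 1) := by
        rw [← hD, hΩ]; ring
      rw [hD] at n2
      rw [hw₁, hw₂]
      fin_cases a <;> fin_cases i <;> fin_cases j <;> simp [form, hc₀, hc₁, hD] <;>
        field_simp <;> simp only [hD'] <;> ring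
    all_goals
      obtain ⟨⟨s1, s2, s3⟩, ⟨s4, s5, s6⟩, s7⟩ := smooth _ hUC
      first
        | exact contDiffOn_const
        | refine contDiffOn_form ?_ ?_
      all_goals repeat' first
        | assumption
        | exact contDiffOn_const
        | apply ContDiffOn.neg
        | apply ContDiffOn.add
        | apply ContDiffOn.sub
        | apply ContDiffOn.div
        | apply ContDiffOn.mul
        | apply ContDiffOn.pow
      all_goals
        intro x hx
        have n0 := hξ0 _ (hUC hx).1
        have n1 := hh0 _ (hUC hx).2
        have n2 : Ω (x 1) (x 2) + 2 * ξ (x 1) * h₂ (x 2) ≠ 0 := hUC0 x hx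
        exact mul_ne_zero (by assumption) n2
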